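/- Let $d\in\mathbb N$ and let $\Omega=\mathbb T^d=\mathbb R^d/\mathbb Z^d$ be the flat torus. Let $\phi,\psi\in C^1(\Omega)$ with $\phi<\psi$ in $\Omega$. For $\varepsilon>0$ and $p\in\mathbb R^d$ set $|p|_\varepsilon=\sqrt{\varepsilon^2+|p|^2}$, and for $v:\Omega\to\mathbb R$ set \[ V_\varepsilon(v)=\frac1\varepsilon(\phi-v)_+^4+\frac1\varepsilon(v-\psi)_+^4 , \qquad E_\varepsilon(v)=\int_\Omega |\nabla v|_\varepsilon+V_\varepsilon(v)\,dx \quad (v\in C^1(\Omega)), \] and let, for $v\in W^{1,\infty}(\Omega)$, $E(v)=\int_\Omega|\nabla v|\,dx$ if $\phi\le v\le\psi$ everywhere in $\Omega$, and $E(v)=+\infty$ otherwise. Let $u_\varepsilon\in C^1(\Omega)$ for $\varepsilon\in(0,1)$, and let $u\in W^{1,\infty}(\Omega)$. Assume: (A1) $\sup_{\varepsilon\in(0,1),\,x\in\Omega}\{|u_\varepsilon(x)|,|\nabla u_\varepsilon(x)|\}<\infty$; (A2) $u_\varepsilon\to u$ uniformly in $\Omega$ as $\varepsilon\to0$, and $\phi\le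 u\le\psi$ in $\Omega$; (A3) $\nabla u_\varepsilon\rightharpoonup\nabla u$ weakly-$*$ in $L^\infty(\Omega;\mathbb R^d)$ as $\varepsilon\to0$; (A4) $\sup_{\varepsilon\in(0,1)}\int_\Omega|-H_\varepsilon+f_\varepsilon|\,dx<\infty$, where $H_\varepsilon=-\operatorname{div}\bigl(\nabla u_\varepsilon/|\nabla u_\varepsilon|_\varepsilon\bigr)$ (in the weak sense, as a function in $L^1(\Omega)$) and $f_\varepsilon=-V_\varepsilon'(u_\varepsilon)=\frac4\varepsilon(\phi-u_\varepsilon)_+^3-\frac4\varepsilon(u_\varepsilon-\psi)_+^3$. If $\lim_{\varepsilon\to0}E_\varepsilon(u_\varepsilon)=E(u)$, then \[ \lim_{\varepsilon\to0}\int_\Omega V_\varepsilon(u_\varepsilon)\,dx=0 . \] -/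

import Mathlib

open MeasureTheory Filter Topology
open scoped ContDiff

noncomputable section

namespace ObstacleMCF

/-- `ℝ^d` with its Euclidean norm. Functions on the flat torus `𝕋^d = ℝ^d / ℤ^d` are
represented by `ℤ^d`-periodic functions on this space. -/
abbrev Eucl (d : ℕ) : Type := EuclideanSpace ℝ (Fin d)

/-- `ℤ^d`-periodicity. -/
def IsPeriodic {d : ℕ} {F : Type*} (f : Eucl d → F) : Prop :=
  ∀ (x : Eucl d) (i : Fin d), f (x + EuclideanSpace.single i (1 : ℝ)) = f x

/-- The fundamental cell `[0,1)^d`; integrals over the torus are integrals over it. -/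
def cell (d : ℕ) : Set (Eucl d) := {x | ∀ i, x i ∈ Set.Ico (0 : ℝ) 1}

/-- `u ∈ C^1(𝕋^d)`. -/
def IsC1 {d : ℕ} (u : Eucl d → ℝ) : Prop := IsPeriodic u ∧ ContDiff ℝ 1 u

/-- Smooth test functions on the torus. -/
def IsTest {d : ℕ} (ζ : Eucl d → ℝ) : Prop := IsPeriodic ζ ∧ ContDiff ℝ ∞ ζ

/-- `w ∈ L^∞(𝕋^d; F)` (as a function, not an equivalence class). -/
def IsLInfty {d : ℕ} {F : Type*} [NormedAddCommGroup F] (w : Eucl d → F) : Prop :=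
  IsPeriodic w ∧ AEStronglyMeasurable w (volume.restrict (cell d)) ∧
    ∃ C : ℝ, ∀ᵐ x ∂(volume.restrict (cell d)), ‖w x‖ ≤ C

/-- `G ∈ L^∞(𝕋^d; ℝ^d)` is the weak gradient of `u` on the torus. -/
def IsWeakGrad {d : ℕ} (u : Eucl d → ℝ) (G : Eucl d → Eucl d) : Prop :=
  IsLInfty G ∧
    ∀ ζ : Eucl d → ℝ, IsTest ζ →
      ∫ x in cell d, u x • gradient ζ x = -∫ x in cell d, ζ x • G x

/-- `u ∈ W^{1,∞}(𝕋^d)`. -/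
def IsW1Infty {d : ℕ} (u : Eucl d → ℝ) : Prop :=
  IsLInfty u ∧ ∃ G : Eucl d → Eucl d, IsWeakGrad u G

open Classical in
/-- A representative of the (a.e. unique) weak gradient of `u ∈ W^{1,∞}(𝕋^d)`. -/
def weakGrad {d : ℕ} (u : Eucl d → ℝ) : Eucl d → Eucl d :=
  if h : ∃ G : Eucl d → Eucl d, IsWeakGrad u G then h.choose else 0

/-- `h ∈ L^1(𝕋^d)` is the weak divergence of the vector field `X` on the torus. -/
def IsWeakDiv {d : ℕ} (X : Eucl d → Eucl d) (h : Eucl d → ℝ) : Prop :=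
  IsPeriodic h ∧ IntegrableOn h (cell d) ∧
    ∀ ζ : Eucl d → ℝ, IsTest ζ →
      ∫ x in cell d, h x * ζ x = -∫ x in cell d, inner ℝ (X x) (gradient ζ x)

/-- Weak-* convergence in `L^∞(𝕋^d; ℝ^d)` as `ε → 0⁺`, i.e. against all
test fields in `L^1(𝕋^d; ℝ^d)`. -/
def WeakStarTendsto {d : ℕ} (w : ℝ → Eucl d → Eucl d) (w₀ : Eucl d → Eucl d) : Prop :=
  ∀ η : Eucl d → Eucl d, IntegrableOn η (cell d) →
    Tendsto (fun ε => ∫ x in cell d, inner ℝ (w ε x) (η x)) (𝓝[>] 0)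
      (𝓝 (∫ x in cell d, inner ℝ (w₀ x) (η x)))

/-- `|p|_ε = √(ε² + |p|²)`. -/
def epsNorm {d : ℕ} (ε : ℝ) (p : Eucl d) : ℝ := Real.sqrt (ε ^ 2 + ‖p‖ ^ 2)

/-- The penalization `s ↦ (a - s)₊⁴ / ε + (s - b)₊⁴ / ε` at obstacle values `a`, `b`. -/
def potential (ε a b s : ℝ) : ℝ :=
  1 / ε * (max (a - s) 0) ^ 4 + 1 / ε * (max (s - b) 0) ^ 4

/-- The forcing term `f_ε = - V_ε'(u)`, the derivative being with respect to the value of `u`. -/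
def force {d : ℕ} (φ ψ : Eucl d → ℝ) (ε : ℝ) (u : Eucl d → ℝ) (x : Eucl d) : ℝ :=
  -deriv (potential ε (φ x) (ψ x)) (u x)

/-- The potential energy `∫_Ω V_ε(u) dx`. -/
def potentialEnergy {d : ℕ} (φ ψ : Eucl d → ℝ) (ε : ℝ) (u : Eucl d → ℝ) : ℝ :=
  ∫ x in cell d, potential ε (φ x) (ψ x) (u x)

/-- The energy `E_ε(u) = ∫_Ω √(ε² + |∇u|²) + V_ε(u) dx` of `u ∈ C^1(𝕋^d)`. -/
def energyEps {d : ℕ} (φ ψ : Eucl d → ℝ) (ε : ℝ) (u : Eucl d → ℝ) : ℝ :=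
  ∫ x in cell d, (epsNorm ε (gradient u x) + potential ε (φ x) (ψ x) (u x))

open Classical in
/-- The limit energy of `u ∈ W^{1,∞}(𝕋^d)`: `∫_Ω |∇u| dx` if `φ ≤ u ≤ ψ` everywhere,
and `+∞` otherwise. -/
def energy {d : ℕ} (φ ψ : Eucl d → ℝ) (u : Eucl d → ℝ) : EReal :=
  if {x | ψ x < u x ∨ u x < φ x} = ∅ then
    ((∫ x in cell d, ‖weakGrad u x‖ : ℝ) : EReal)
  else ⊤

/-- The regularized normal `ν_ε = -∇u / |∇u|_ε`. -/
def normalEps {d : ℕ} (ε : ℝ) (u : Eucl d → ℝ) (x : Eucl d) : Eucl d :=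
  -((epsNorm ε (gradient u x))⁻¹ • gradient u x)

end ObstacleMCF

end

/-!
The dual field `η = ∇u / |∇u|` has norm at most one, so `∫ ⟨∇u_ε, η⟩ ≤ ∫ |∇u_ε|_ε` and hence
`0 ≤ ∫ V_ε(u_ε) ≤ E_ε(u_ε) - ∫ ⟨∇u_ε, η⟩`. The energies on the right converge to `∫ |∇u|` by
assumption, the integrals of `⟨∇u_ε, η⟩` converge to `∫ ⟨∇u, η⟩ = ∫ |∇u|` by weak-* convergence.
-/

namespace ObstacleMCF

section Normalize

variable {E : Type*} [NormedAddCommGroup E]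

lemma norm_normalize_le_one [NormedSpace ℝ E] (p : E) : ‖NormedSpace.normalize p‖ ≤ 1 := by
  rw [NormedSpace.normalize, norm_smul, norm_inv, norm_norm]
  exact inv_mul_le_one

lemma real_inner_normalize_self [InnerProductSpace ℝ E] (p : E) :
    inner ℝ p (NormedSpace.normalize p) = ‖p‖ := by
  rw [NormedSpace.normalize, real_inner_smul_right, real_inner_self_eq_norm_sq, sq,
    ← mul_assoc, inv_mul_mul_self]

variable {α : Type*} {mα : MeasurableSpace α} {μ : Measure α}

lemma integrable_normalize [NormedSpace ℝ E] [IsFiniteMeasure μ] {G : α → E}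
    (hG : AEStronglyMeasurable G μ) : Integrable (fun x => NormedSpace.normalize (G x)) μ :=
  .of_bound (hG.norm.aemeasurable.inv.aestronglyMeasurable.smul hG) 1
    (.of_forall fun x => norm_normalize_le_one (G x))

lemma integral_inner_le_integral_norm [InnerProductSpace ℝ E] {f η : α → E}
    (hf : Integrable f μ) (hη : ∀ᵐ x ∂μ, ‖η x‖ ≤ 1) :
    ∫ x, inner ℝ (f x) (η x) ∂μ ≤ ∫ x, ‖f x‖ ∂μ := by
  refine (Real.le_norm_self _).trans (norm_integral_le_of_norm_le hf.norm ?_)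
  filter_upwards [hη] with x hx
  exact (norm_inner_le_norm _ _).trans (mul_le_of_le_one_right (norm_nonneg _) hx)

end Normalize

section Cell

variable {d : ℕ}

lemma isBounded_cell (d : ℕ) : Bornology.IsBounded (cell d) :=
  ((PiLp.antilipschitzWith_ofLp 2 fun _ : Fin d => ℝ).isBounded_preimage
    (Metric.isBounded_Icc 0 1)).subset fun _ hx => ⟨fun i => (hx i).1, fun i => (hx i).2.le⟩

instance isFiniteMeasure_restrict_cell : IsFiniteMeasure (volume.restrict (cell d)) :=
  isFiniteMeasure_restrict.2 (isBounded_cell d).measure_lt_top.ne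

lemma integrableOn_cell_of_continuous {F : Type*} [NormedAddCommGroup F] {f : Eucl d → F}
    (hf : Continuous f) : IntegrableOn f (cell d) :=
  (hf.continuousOn.integrableOn_compact (isBounded_cell d).isCompact_closure).mono_set
    subset_closure

lemma WeakStarTendsto.tendsto_integral_inner_normalize {w : ℝ → Eucl d → Eucl d}
    {G : Eucl d → Eucl d} (hw : WeakStarTendsto w G)
    (hG : AEStronglyMeasurable G (volume.restrict (cell d))) :
    Tendsto (fun ε => ∫ x in cell d, inner ℝ (w ε x) (NormedSpace.normalize (G x))) (𝓝[>] 0)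
      (𝓝 (∫ x in cell d, ‖G x‖)) := by
  simpa only [real_inner_normalize_self] using hw _ (integrable_normalize hG)

end Cell

section Energy

variable {d : ℕ} {φ ψ v : Eucl d → ℝ} {ε : ℝ}

lemma continuous_gradient {F : Type*} [NormedAddCommGroup F] [InnerProductSpace ℝ F]
    [CompleteSpace F] {f : F → ℝ} (hf : ContDiff ℝ 1 f) : Continuous (gradient f) :=
  (InnerProductSpace.toDual ℝ F).symm.continuous.comp (hf.continuous_fderiv one_ne_zero)

lemma continuous_epsNorm (ε : ℝ) : Continuous (epsNorm ε : Eucl d → ℝ) := by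
  unfold epsNorm
  fun_prop

lemma norm_le_epsNorm (ε : ℝ) (p : Eucl d) : ‖p‖ ≤ epsNorm ε p :=
  Real.le_sqrt_of_sq_le (le_add_of_nonneg_left (sq_nonneg ε))

lemma continuous_potential (hφ : Continuous φ) (hψ : Continuous ψ) (hv : Continuous v) (ε : ℝ) :
    Continuous fun x => potential ε (φ x) (ψ x) (v x) := by
  unfold potential
  fun_prop

lemma potential_nonneg (hε : 0 ≤ ε) (a b s : ℝ) : 0 ≤ potential ε a b s := by
  unfold potential
  positivity

lemma potentialEnergy_nonneg (hε : 0 ≤ ε) (φ ψ v : Eucl d → ℝ) :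
    0 ≤ potentialEnergy φ ψ ε v :=
  integral_nonneg fun _ => potential_nonneg hε _ _ _

lemma integral_inner_gradient_le_integral_epsNorm (hv : ContDiff ℝ 1 v) (ε : ℝ)
    {η : Eucl d → Eucl d} (hη : ∀ᵐ x ∂volume.restrict (cell d), ‖η x‖ ≤ 1) :
    ∫ x in cell d, inner ℝ (gradient v x) (η x) ≤
      ∫ x in cell d, epsNorm ε (gradient v x) := by
  have hgrad := continuous_gradient hv
  calc ∫ x in cell d, inner ℝ (gradient v x) (η x)
      ≤ ∫ x in cell d, ‖gradient v x‖ :=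
        integral_inner_le_integral_norm (integrableOn_cell_of_continuous hgrad) hη
    _ ≤ ∫ x in cell d, epsNorm ε (gradient v x) :=
        integral_mono (integrableOn_cell_of_continuous hgrad.norm)
          (integrableOn_cell_of_continuous ((continuous_epsNorm ε).comp hgrad))
          fun x => norm_le_epsNorm ε (gradient v x)

lemma energyEps_eq_add (hφ : Continuous φ) (hψ : Continuous ψ) (hv : ContDiff ℝ 1 v) (ε : ℝ) :
    energyEps φ ψ ε v =
      (∫ x in cell d, epsNorm ε (gradient v x)) + potentialEnergy φ ψ ε v :=
  integral_add
    (integrableOn_cell_of_continuous ((continuous_epsNorm ε).comp (continuous_gradient hv)))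
    (integrableOn_cell_of_continuous (continuous_potential hφ hψ hv.continuous ε))

lemma potentialEnergy_le_energyEps_sub (hφ : Continuous φ) (hψ : Continuous ψ)
    (hv : ContDiff ℝ 1 v) (ε : ℝ) {η : Eucl d → Eucl d}
    (hη : ∀ᵐ x ∂volume.restrict (cell d), ‖η x‖ ≤ 1) :
    potentialEnergy φ ψ ε v ≤
      energyEps φ ψ ε v - ∫ x in cell d, inner ℝ (gradient v x) (η x) := by
  rw [energyEps_eq_add hφ hψ hv]
  linarith [integral_inner_gradient_le_integral_epsNorm hv ε hη]

lemma IsW1Infty.isWeakGrad_weakGrad (hv : IsW1Infty v) : IsWeakGrad v (weakGrad v) := by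
  rw [weakGrad, dif_pos hv.2]
  exact hv.2.choose_spec

lemma energy_eq_integral_norm_weakGrad (hv : ∀ x, φ x ≤ v x ∧ v x ≤ ψ x) :
    energy φ ψ v = ((∫ x in cell d, ‖weakGrad v x‖ : ℝ) : EReal) :=
  if_pos (Set.eq_empty_of_forall_notMem fun x hx =>
    hx.elim (hv x).2.not_gt (hv x).1.not_gt)

end Energy

end ObstacleMCF

open ObstacleMCF in
theorem mainTheorem12_general {d : ℕ} {φ ψ : Eucl d → ℝ} (hφ : Continuous φ) (hψ : Continuous ψ)
    {u : ℝ → Eucl d → ℝ} {u₀ : Eucl d → ℝ} (hu : ∀ᶠ ε in 𝓝[>] 0, ContDiff ℝ 1 (u ε))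
    (hu₀ : IsW1Infty u₀) (hbetween : ∀ x, φ x ≤ u₀ x ∧ u₀ x ≤ ψ x)
    (hgrad : WeakStarTendsto (fun ε => gradient (u ε)) (weakGrad u₀))
    (hE : Tendsto (fun ε => (energyEps φ ψ ε (u ε) : EReal)) (𝓝[>] 0) (𝓝 (energy φ ψ u₀))) :
    Tendsto (fun ε => potentialEnergy φ ψ ε (u ε)) (𝓝[>] 0) (𝓝 0) := by
  rw [energy_eq_integral_norm_weakGrad hbetween, EReal.tendsto_coe] at hE
  have hdual := hgrad.tendsto_integral_inner_normalize hu₀.isWeakGrad_weakGrad.1.2.1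
  have hgap := hE.sub hdual
  rw [sub_self] at hgap
  refine tendsto_of_tendsto_of_tendsto_of_le_of_le' tendsto_const_nhds hgap ?_ ?_
  · filter_upwards [self_mem_nhdsWithin] with ε hε
    exact potentialEnergy_nonneg (le_of_lt hε) φ ψ (u ε)
  · filter_upwards [hu] with ε hε
    exact potentialEnergy_le_energyEps_sub hφ hψ hε ε
      (.of_forall fun x => norm_normalize_le_one (weakGrad u₀ x))

open ObstacleMCF in
theorem mainTheorem12 (d : ℕ) (φ ψ : Eucl d → ℝ) (hφ : IsC1 φ) (hψ : IsC1 ψ)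
    (hφψ : ∀ x, φ x < ψ x)
    (u : ℝ → Eucl d → ℝ) (u₀ : Eucl d → ℝ)
    (hu : ∀ ε ∈ Set.Ioo (0 : ℝ) 1, IsC1 (u ε)) (hu₀ : IsW1Infty u₀)
    -- uniform bounds on `u_ε` and `∇u_ε`
    (hA1 : ∃ C : ℝ, ∀ ε ∈ Set.Ioo (0 : ℝ) 1, ∀ x, |u ε x| ≤ C ∧ ‖gradient (u ε) x‖ ≤ C)
    -- uniform convergence, and the constraint for the limit
    (hA2 : TendstoUniformly u u₀ (𝓝[>] 0) ∧ ∀ x, φ x ≤ u₀ x ∧ u₀ x ≤ ψ x)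
    -- weak-* convergence of the gradients
    (hA3 : WeakStarTendsto (fun ε => gradient (u ε)) (weakGrad u₀))
    -- uniform `L^1` bound on `-H_ε + f_ε`, where `H_ε = div ν_ε`
    (hA4 : ∃ (H : ℝ → Eucl d → ℝ) (C : ℝ), ∀ ε ∈ Set.Ioo (0 : ℝ) 1,
      IsWeakDiv (normalEps ε (u ε)) (H ε) ∧
        ∫ x in cell d, |-(H ε x) + force φ ψ ε (u ε) x| ≤ C)
    (hE : Tendsto (fun ε => (energyEps φ ψ ε (u ε) : EReal)) (𝓝[>] 0) (𝓝 (energy φ ψ u₀))) :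
    Tendsto (fun ε => potentialEnergy φ ψ ε (u ε)) (𝓝[>] 0) (𝓝 0) := by
  exact mainTheorem12_general hφ.2.continuous hψ.2.continuous
    (mem_of_superset (Ioo_mem_nhdsGT one_pos) fun ε hε => (hu ε hε).2) hu₀ hA2.2 hA3 hE
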